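/- Let $q\in\mathbb N$, $\alpha\in\mathbb R$ and $\kappa\in\mathbb N_0\cup\{+\infty\}$. All sequences below consist of complex $q\times q$ matrices, and $A^\dagger$ denotes the Moore–Penrose inverse of a complex matrix $A$. Definitions. For a sequence $(s_j)_{j=0}^{\kappa}$ let $H_n^{\langle s\rangle}=[s_{j+k}]_{j,k=0}^{n}$ (for $2n\le\kappa$), and, if $\kappa\ge1$, let $s^{(\alpha)}_j=-\alpha s_j+s_{j+1}$ for $0\le j\le\kappa-1$. (a) For $m\in\mathbb N_0$, the set $\mathcal K^{\ge}_{q,m,\alpha}$ consists of all sequences $(s_j)_{j=0}^m$ such that: if $m=0$, $H_0^{\langle s\rangle}=s_0$ is non-negative Hermitian; if $m=2n$ with $n\ge1$, $H_n^{\langle s\rangle}$ and $H_{n-1}^{\langle s^{(\alpha)}\rangle}$ are non-negative Hermitian; if $m=2n+1$ with $n\ge 0$, $H_n^{\langle s\rangle}$ and $H_n^{\langle s^{(\alpha)}\rangle}$ are non-negative Hermitian. For $m\in\mathbb N_0$, the set $\mathcal K^{\ge,e}_{q,m,\alpha}$ consists of all $(s_j)_{j=0}^m$ for which there is a complex $q\times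 q$ matrix $s_{m+1}$ with $(s_j)_{j=0}^{m+1}\in\mathcal K^{\ge}_{q,m+1,\alpha}$. Finally, $\mathcal K^{\ge,e}_{q,\infty,\alpha}$ consists of all $(s_j)_{j=0}^\infty$ with $(s_j)_{j=0}^m\in\mathcal K^{\ge}_{q,m,\alpha}$ for all $m\in\mathbb N_0$. (b) Let $L_0^{\langle s\rangle}=s_0$ and, for $n\ge1$ with $2n\le\kappa$, $$L_n^{\langle s\rangle}=s_{2n}-[s_n,s_{n+1},\dots,s_{2n-1}]\,\bigl(H_{n-1}^{\langle s\rangle}\bigr)^\dagger\begin{bmatrix}s_n\\ s_{n+1}\\ \vdots\\ s_{2n-1}\end{bmatrix}.$$ The (right) $\alpha$-Stieltjes parametrization of $(s_j)_{j=0}^\kappa$ is the sequence $(Q_j)_{j=0}^\kappa$ given by $Q_{2k}=L_k^{\langle s\rangle}$ for $2k\le\kappa$ and $Q_{2k+1}=L_k^{\langle s^{(\alpha)}\rangle}$ for $2k+1\le\kappa$. (c) The reciprocal sequence $(u_j^\sharp)_{j=0}^\kappa$ of a sequence $(u_j)_{j=0}^\kappa$ is given by $u_0^\sharp=u_0^\dagger$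 and $u_j^\sharp=-u_0^\dagger\sum_{l=0}^{j-1}u_{j-l}u_l^\sharp$ for $1\le j\le\kappa$. If $\kappa\ge1$, the first $\alpha$-Schur–Stieltjes transform of $(s_j)_{j=0}^\kappa$ is the sequence $(-s_0u_{j+1}^\sharp s_0)_{j=0}^{\kappa-1}$, where $u_0=s_0$ and $u_j=-\alpha s_{j-1}+s_j$ for $1\le j\le\kappa$. The $0$-th $\alpha$-Schur–Stieltjes transform of $(s_j)_{j=0}^\kappa$ is $(s_j)_{j=0}^\kappa$ itself, and for $1\le k\le\kappa$ the $k$-th one, of the form $(t_j)_{j=0}^{\kappa-k}$, is the first transform of the $(k-1)$-th one. Theorem. Let $(s_j)_{j=0}^\kappa\in\mathcal K^{\ge,e}_{q,\kappa,\alpha}$, and let $k$ be an integer with $0\le k\le\kappa$. Denote by $(t_j)_{j=0}^{\kappa-k}$ the $k$-th $\alpha$-Schur–Stieltjes transform of $(s_j)_{j=0}^\kappa$ and by $(Q_j)_{j=0}^\kappa$ the $\alpha$-Stieltjes parametrization of $(s_j)_{j=0}^\kappa$. Then $(Q_{k+j})_{j=0}^{\kappa-k}$ is exactly the $\alpha$-Stieltjes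 parametrization of $(t_j)_{j=0}^{\kappa-k}$. -/

import Mathlib

open scoped Matrix ComplexOrder

/-! Matrices over `ℂ`. A finite or infinite sequence `(s_j)_{j=0}^κ`, `κ ∈ ℕ ∪ {∞}`, is encoded as
a function `s : ℕ → Matrix _ _ ℂ` together with `κ : ℕ∞`; entries of index `> κ` are irrelevant: every
notion below with index `j` (or length `κ`) involves only the entries it may involve. -/

namespace StieltjesSchur

/-- The four Penrose equations: `X` is a Moore-Penrose inverse of `A`. -/
structure IsMoorePenrose {m n : Type*} [Fintype m] [Fintype n]
    (A : Matrix m n ℂ) (X : Matrix n m ℂ) : Prop where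
  mul_mul_self : A * X * A = A
  self_mul_mul : X * A * X = X
  left_herm : (A * X)ᴴ = A * X
  right_herm : (X * A)ᴴ = X * A

theorem exists_isMoorePenrose {m n : Type*} [Fintype m] [Fintype n]
    (A : Matrix m n ℂ) : ∃ X : Matrix n m ℂ, IsMoorePenrose A X := by
  classical
  obtain ⟨H, hHdef⟩ : ∃ H, H = Aᴴ * A := ⟨_, rfl⟩
  have hH : H.IsHermitian := by rw [hHdef]; exact Matrix.isHermitian_conjTranspose_mul_self A
  obtain ⟨G, hG, hGH, hHGH, hGHG⟩ : ∃ G : Matrix n n ℂ,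
      Gᴴ = G ∧ G * H = H * G ∧ H * G * H = H ∧ G * H * G = G := by
    obtain ⟨U, hUdef⟩ : ∃ U : Matrix n n ℂ, U = (hH.eigenvectorUnitary : Matrix n n ℂ) := ⟨_, rfl⟩
    obtain ⟨d, hd⟩ : ∃ d : n → ℂ, d = fun i => (hH.eigenvalues i : ℂ) := ⟨_, rfl⟩
    have hU : Uᴴ * U = 1 := by
      rw [hUdef]; exact Unitary.coe_star_mul_self hH.eigenvectorUnitary
    have hspec : H = U * Matrix.diagonal d * Uᴴ := by
      have h := hH.spectral_theorem
      rw [Unitary.conjStarAlgAut_apply] at h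
      rw [hUdef, hd]
      exact h
    have key : ∀ a b : n → ℂ, (U * Matrix.diagonal a * Uᴴ) * (U * Matrix.diagonal b * Uᴴ)
        = U * Matrix.diagonal (fun i => a i * b i) * Uᴴ := by
      intro a b
      calc (U * Matrix.diagonal a * Uᴴ) * (U * Matrix.diagonal b * Uᴴ)
          = U * Matrix.diagonal a * (Uᴴ * U) * Matrix.diagonal b * Uᴴ := by
            simp only [Matrix.mul_assoc]
        _ = _ := by
            rw [hU, Matrix.mul_one, Matrix.mul_assoc U, Matrix.diagonal_mul_diagonal]
    refine ⟨U * Matrix.diagonal (fun i => (d i)⁻¹) * Uᴴ, ?_, ?_, ?_, ?_⟩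
    · rw [Matrix.conjTranspose_mul, Matrix.conjTranspose_mul, Matrix.conjTranspose_conjTranspose,
        Matrix.diagonal_conjTranspose, Matrix.mul_assoc]
      congr 3
      ext i
      simp [hd]
    · rw [hspec, key, key]
      simp only [mul_comm]
    · rw [hspec, key, key]
      congr 3
      ext i
      by_cases h : d i = 0 <;> simp [h]
    · rw [hspec, key, key]
      congr 3
      ext i
      by_cases h : d i = 0 <;> simp [h]
  refine ⟨G * Aᴴ, ?_, ?_, ?_, ?_⟩
  · have h1 : A * (G * Aᴴ) * A = A * G * H := by rw [hHdef]; simp only [Matrix.mul_assoc]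
    rw [h1, ← sub_eq_zero, ← Matrix.conjTranspose_mul_self_eq_zero]
    have h2 : (A * G * H - A)ᴴ * (A * G * H - A) = (H * G - 1) * (H * G * H - H) := by
      have e1 : (A * G * H - A)ᴴ = (H * G - 1) * Aᴴ := by
        rw [Matrix.conjTranspose_sub, Matrix.conjTranspose_mul, Matrix.conjTranspose_mul, hG,
          hH.eq, Matrix.sub_mul, Matrix.one_mul, Matrix.mul_assoc]
      rw [e1, Matrix.mul_assoc, Matrix.mul_sub]
      congr 2
      · rw [hHdef]
        simp only [Matrix.mul_assoc]
      · exact hHdef.symm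
    rw [h2, hHGH, sub_self, Matrix.mul_zero]
  · calc G * Aᴴ * A * (G * Aᴴ) = G * (Aᴴ * A) * G * Aᴴ := by simp only [Matrix.mul_assoc]
      _ = G * Aᴴ := by rw [← hHdef, hGHG]
  · rw [Matrix.conjTranspose_mul, Matrix.conjTranspose_mul, hG, Matrix.conjTranspose_conjTranspose,
      Matrix.mul_assoc]
  · rw [Matrix.mul_assoc, ← hHdef, Matrix.conjTranspose_mul, hG, hH.eq, hGH]

theorem IsMoorePenrose.unique {m n : Type*} [Fintype m] [Fintype n]
    {A : Matrix m n ℂ} {X Y : Matrix n m ℂ} (hX : IsMoorePenrose A X) (hY : IsMoorePenrose A Y) :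
    X = Y := by
  have h1 : A * X = A * Y := by
    calc A * X = (A * X)ᴴ := hX.left_herm.symm
      _ = ((A * Y) * (A * X))ᴴ := by rw [← Matrix.mul_assoc, hY.mul_mul_self]
      _ = (A * X) * (A * Y) := by rw [Matrix.conjTranspose_mul, hX.left_herm, hY.left_herm]
      _ = A * Y := by rw [← Matrix.mul_assoc, hX.mul_mul_self]
  have h2 : X * A = Y * A := by
    calc X * A = (X * A)ᴴ := hX.right_herm.symm
      _ = ((X * A) * (Y * A))ᴴ := by
        rw [Matrix.mul_assoc, ← Matrix.mul_assoc A Y, hY.mul_mul_self]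
      _ = (Y * A) * (X * A) := by rw [Matrix.conjTranspose_mul, hX.right_herm, hY.right_herm]
      _ = Y * A := by rw [Matrix.mul_assoc, ← Matrix.mul_assoc A X, hX.mul_mul_self]
  calc X = X * A * X := hX.self_mul_mul.symm
    _ = Y * A * Y := by rw [h2, Matrix.mul_assoc, h1, ← Matrix.mul_assoc]
    _ = Y := hY.self_mul_mul

/-- The Moore-Penrose inverse `A†` of a complex matrix. -/
noncomputable def moorePenrose {m n : Type*} [Fintype m] [Fintype n]
    (A : Matrix m n ℂ) : Matrix n m ℂ :=
  Classical.choose (exists_isMoorePenrose A)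

theorem moorePenrose_spec {m n : Type*} [Fintype m] [Fintype n] (A : Matrix m n ℂ) :
    IsMoorePenrose A (moorePenrose A) :=
  Classical.choose_spec (exists_isMoorePenrose A)

/-- The block Hankel matrix `H_n = [s_{j+k}]_{j,k=0}^n`. -/
def blockHankel {p q : ℕ} (s : ℕ → Matrix (Fin p) (Fin q) ℂ) (n : ℕ) :
    Matrix (Fin (n + 1) × Fin p) (Fin (n + 1) × Fin q) ℂ :=
  Matrix.of fun a b => s (a.1.val + b.1.val) a.2 b.2

/-- The block column `col (s_j)_{j=l}^{l+n}`. -/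
def blockCol {p q : ℕ} (s : ℕ → Matrix (Fin p) (Fin q) ℂ) (l n : ℕ) :
    Matrix (Fin (n + 1) × Fin p) (Fin q) ℂ :=
  Matrix.of fun a b => s (l + a.1.val) a.2 b

/-- The block row `[s_l, s_{l+1}, …, s_{l+n}]`. -/
def blockRow {p q : ℕ} (s : ℕ → Matrix (Fin p) (Fin q) ℂ) (l n : ℕ) :
    Matrix (Fin p) (Fin (n + 1) × Fin q) ℂ :=
  Matrix.of fun a b => s (l + b.1.val) a b.2

/-- `L_0 = s_0` and `L_n = s_{2n} - [s_n, …, s_{2n-1}] (H_{n-1})† col(s_n, …, s_{2n-1})`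
for `n ≥ 1`. -/
noncomputable def schurComplement {p q : ℕ} (s : ℕ → Matrix (Fin p) (Fin q) ℂ) :
    ℕ → Matrix (Fin p) (Fin q) ℂ
  | 0 => s 0
  | n + 1 => s (2 * (n + 1)) -
      blockRow s (n + 1) n * moorePenrose (blockHankel s n) * blockCol s (n + 1) n

/-- The right `α`-shifted sequence, `-α s_j + s_{j+1}`. -/
noncomputable def alphaShift {p q : ℕ} (α : ℂ) (s : ℕ → Matrix (Fin p) (Fin q) ℂ) :
    ℕ → Matrix (Fin p) (Fin q) ℂ :=
  fun j => -(α • s j) + s (j + 1)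

/-- The right `α`-Stieltjes parametrization `(Q_j)` of `(s_j)`: `Q_{2k}` is `L_k` formed from `s`,
`Q_{2k+1}` is `L_k` formed from the right `α`-shifted sequence. -/
noncomputable def stieltjesParam {p q : ℕ} (α : ℂ) (s : ℕ → Matrix (Fin p) (Fin q) ℂ) :
    ℕ → Matrix (Fin p) (Fin q) ℂ :=
  fun j => if Even j then schurComplement s (j / 2) else schurComplement (alphaShift α s) (j / 2)

/-- Membership of `(s_j)_{j=0}^m` in `K^≥_{q,m,α}`, `α`-Stieltjes non-negative definite sequences:
for `m = 0`, `H_0` is non-negative Hermitian; for `m = 2n` with `n ≥ 1`, `H_n` formed from `s` and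
`H_{n-1}` formed from the right `α`-shifted sequence are; for `m = 2n+1`, both `H_n` are. -/
def IsStieltjesNND {q : ℕ} (α : ℝ) (m : ℕ) (s : ℕ → Matrix (Fin q) (Fin q) ℂ) : Prop :=
  (blockHankel s (m / 2)).PosSemidef ∧
    (1 ≤ m → (blockHankel (alphaShift (α : ℂ) s) ((m - 1) / 2)).PosSemidef)

/-- Membership of `(s_j)_{j=0}^κ` in `K^{≥,e}_{q,κ,α}`, `κ ∈ ℕ ∪ {∞}`: for `κ = m` finite, there
is a matrix `s_{m+1}` such that `(s_j)_{j=0}^{m+1}` lies in `K^≥_{q,m+1,α}`; for `κ = ∞`, every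
`(s_j)_{j=0}^m` lies in `K^≥_{q,m,α}`. -/
def IsStieltjesNNDExt {q : ℕ} (α : ℝ) (κ : ℕ∞) (s : ℕ → Matrix (Fin q) (Fin q) ℂ) : Prop :=
  (∀ m : ℕ, κ = (m : ℕ∞) → ∃ X : Matrix (Fin q) (Fin q) ℂ,
    IsStieltjesNND α (m + 1) (Function.update s (m + 1) X)) ∧
  (κ = ⊤ → ∀ m : ℕ, IsStieltjesNND α m s)

/-- The reciprocal sequence `(s_j^♯)`: `s_0^♯ = s_0†` and
`s_j^♯ = -s_0† ∑_{l=0}^{j-1} s_{j-l} s_l^♯` for `j ≥ 1`. -/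
noncomputable def reciprocalSeq {p q : ℕ} (s : ℕ → Matrix (Fin p) (Fin q) ℂ) :
    ℕ → Matrix (Fin q) (Fin p) ℂ
  | 0 => moorePenrose (s 0)
  | j + 1 => -(moorePenrose (s 0) *
      ∑ l : Fin (j + 1), s (j + 1 - l.val) * reciprocalSeq s l.val)
  termination_by j => j
  decreasing_by exact l.isLt

/-- The `[+,α]`-transform `-α s_{j-1} + s_j`, where `s_{-1} = 0`. -/
noncomputable def plusTransform {p q : ℕ} (α : ℂ) (s : ℕ → Matrix (Fin p) (Fin q) ℂ) :
    ℕ → Matrix (Fin p) (Fin q) ℂ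
  | 0 => s 0
  | j + 1 => -(α • s j) + s (j + 1)

/-- The first `α`-Schur-Stieltjes transform `(s_0 (-u_{j+1}^♯) s_0)_j`, where `(u_j^♯)` is the
reciprocal sequence of the `[+,α]`-transform `(u_j)` of `(s_j)`. It shortens a sequence by one. -/
noncomputable def schurStep {p q : ℕ} (α : ℂ) (s : ℕ → Matrix (Fin p) (Fin q) ℂ) :
    ℕ → Matrix (Fin p) (Fin q) ℂ :=
  fun j => s 0 * (-(reciprocalSeq (plusTransform α s) (j + 1))) * s 0

/-- The `k`-th `α`-Schur-Stieltjes transform of `(s_j)`. -/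
noncomputable def schurTransform {p q : ℕ} (α : ℂ) (s : ℕ → Matrix (Fin p) (Fin q) ℂ) :
    ℕ → (ℕ → Matrix (Fin p) (Fin q) ℂ)
  | 0 => s
  | k + 1 => schurStep α (schurTransform α s k)

end StieltjesSchur

/-! Put `S = ∑ s_j X ^ j`, `A = ∑ s^{(α)}_j X ^ j`, let `T` be the generating series of the first
transform `(t_j)` and `B` that of its `α`-shift. The parameters are residuals of Padé
approximation: solving `H_{n-1} y = col(s_n, …, s_{2n-1})` amounts to finding a polynomial `P` of
degree at most `n` with `P(0) = 1` and `S P = Q + X ^ (2n) E`, `deg Q < n`, and then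
`L_n = E(0)`; for a Hermitian sequence this residual does not depend on the choice of `P`.

If `s_0 s_0† s_j = s_j = s_j s_0† s_0` for all `j`, the definition of the transform becomes
`T (1 + X s_0† A) = A`, equivalently `(1 - α X) T s_0† S = A`. Hence a denominator `P` of `A` with
numerator `Q` yields the denominator `P + X s_0† Q` of `T` with the same residual, and a
denominator of `S` of degree `n + 1` with numerator `Q` yields the denominator
`1 - s_0† s_0 + s_0† Q` of `B` of degree `n`, again with the same residual. These are the even and
the odd parameters of `(t_j)`.

The relation `s_j s_0† s_0 = s_j` holds because `ker Q_j ⊆ ker Q_{j+1}`, and unlike non-negative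
definiteness these inclusions pass to `(t_j)` at once, since its parameters are `Q_1, Q_2, …`. They
hold for extendable non-negative definite sequences: multiplying a denominator by an element of
`ker Q_j` makes its residual vanish, and then positivity of the next larger block Hankel matrix
makes one more coefficient vanish. -/

namespace StieltjesSchur

open Finset PowerSeries

section PadeResidual

variable {R : Type*} [Ring R]

/-- A denominator of an `[n - 1 / n]` Padé approximant of `S`: `W` has degree at most `n` and
`S * W = Q + L * X ^ (2 * n) + O(X ^ (2 * n + 1))` with `Q` of degree less than `n`. The polynomial
`W` encodes the column `(W_n, …, W_0)`, which the Hankel matrix `H_n` of the coefficients of `S`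
maps to `(0, …, 0, L)`. -/
structure IsPadeDenominator (S : R⟦X⟧) (n : ℕ) (W : R⟦X⟧) (L : R) : Prop where
  coeff_eq_zero : ∀ i, n < i → coeff i W = 0
  coeff_mul_eq_zero : ∀ i, n ≤ i → i < 2 * n → coeff i (S * W) = 0
  coeff_mul_two_mul : coeff (2 * n) (S * W) = L

/-- `L` is the residual of some Padé denominator of `S` normalized to have constant coefficient
one. -/
def HasPadeResidual (S : R⟦X⟧) (n : ℕ) (L : R) : Prop :=
  ∃ P, constantCoeff P = 1 ∧ IsPadeDenominator S n P L

theorem IsPadeDenominator.of_X_pow_mul_eq_add {S W Q E : R⟦X⟧} {n : ℕ} {L : R} (d : ℕ)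
    (hW : ∀ i, n < i → coeff i W = 0) (hQ : ∀ i, n + d ≤ i → coeff i Q = 0)
    (hE : constantCoeff E = L) (h : X ^ d * (S * W) = Q + X ^ (2 * n + d) * E) :
    IsPadeDenominator S n W L where
  coeff_eq_zero := hW
  coeff_mul_eq_zero i hi hi' := by
    rw [← coeff_X_pow_mul _ d, h, map_add, hQ _ (by omega), coeff_X_pow_mul', if_neg (by omega),
      add_zero]
  coeff_mul_two_mul := by
    rw [← coeff_X_pow_mul _ d, h, map_add, hQ _ (by omega), coeff_X_pow_mul', if_pos le_rfl,
      Nat.sub_self, zero_add, coeff_zero_eq_constantCoeff_apply, hE]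

theorem IsPadeDenominator.exists_eq_add {S W : R⟦X⟧} {n : ℕ} {L : R}
    (h : IsPadeDenominator S n W L) :
    ∃ Q E : R⟦X⟧, (∀ i, n ≤ i → coeff i Q = 0) ∧ constantCoeff E = L ∧
      S * W = Q + X ^ (2 * n) * E := by
  refine ⟨PowerSeries.mk fun i => if i < n then coeff i (S * W) else 0,
    PowerSeries.mk fun i => coeff (2 * n + i) (S * W),
    fun i hi => by rw [coeff_mk, if_neg (by omega)],
    by rw [constantCoeff_mk, add_zero, h.coeff_mul_two_mul], ?_⟩
  ext i
  rw [map_add, coeff_mk, coeff_X_pow_mul', coeff_mk]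
  split_ifs with h₁ h₂ h₂
  · omega
  · rw [add_zero]
  · rw [zero_add, Nat.add_sub_cancel' h₂]
  · rw [add_zero, h.coeff_mul_eq_zero i (by omega) (by omega)]

theorem IsPadeDenominator.mul_C {S W : R⟦X⟧} {n : ℕ} {L : R} (h : IsPadeDenominator S n W L)
    (M : R) : IsPadeDenominator S n (W * C M) (L * M) where
  coeff_eq_zero i hi := by rw [coeff_mul_C, h.coeff_eq_zero i hi, zero_mul]
  coeff_mul_eq_zero i hi hi' := by
    rw [← mul_assoc, coeff_mul_C, h.coeff_mul_eq_zero i hi hi', zero_mul]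
  coeff_mul_two_mul := by rw [← mul_assoc, coeff_mul_C, h.coeff_mul_two_mul]

theorem hasPadeResidual_zero (S : R⟦X⟧) : HasPadeResidual S 0 (constantCoeff S) :=
  ⟨1, map_one _, fun i hi => by rw [coeff_one, if_neg (by omega)], by omega, by simp⟩

theorem HasPadeResidual.congr {S S' : R⟦X⟧} {n : ℕ} {L : R} (hS : HasPadeResidual S n L)
    (h : ∀ i ≤ 2 * n, coeff i S = coeff i S') : HasPadeResidual S' n L := by
  obtain ⟨P, hP₀, hP⟩ := hS
  have hSP : ∀ i ≤ 2 * n, coeff i (S' * P) = coeff i (S * P) := fun i hi => by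
    rw [coeff_mul, coeff_mul]
    exact sum_congr rfl fun p hp => by
      rw [h _ ((Finset.HasAntidiagonal.antidiagonal.fst_le hp).trans hi)]
  exact ⟨P, hP₀, hP.coeff_eq_zero,
    fun i hi hi' => (hSP i hi'.le).trans (hP.coeff_mul_eq_zero i hi hi'),
    (hSP _ le_rfl).trans hP.coeff_mul_two_mul⟩

theorem HasPadeResidual.of_mul_one_add {A T : R⟦X⟧} {g L : R} {n : ℕ}
    (hT : T * (1 + X * (C g * A)) = A) (hA : HasPadeResidual A n L) : HasPadeResidual T n L := by
  obtain ⟨P, hP₀, hP⟩ := hA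
  obtain ⟨Q, E, hQ, rfl, hAP⟩ := hP.exists_eq_add
  have hTP : T * (P + X * (C g * Q)) = Q + X ^ (2 * n) * (E - X * (T * (C g * E))) :=
    calc T * (P + X * (C g * Q))
        = T * (1 + X * (C g * A)) * P - T * X * C g * (A * P - Q) := by noncomm_ring
      _ = Q + X ^ (2 * n) * E - (T * X * C g) * X ^ (2 * n) * E := by
        rw [hT, hAP]
        noncomm_ring
      _ = Q + X ^ (2 * n) * (E - X * (T * (C g * E))) := by
        rw [(commute_X_pow _ _).eq, (commute_X T).eq]
        noncomm_ring
  refine ⟨P + X * (C g * Q), by simp [hP₀],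
    .of_X_pow_mul_eq_add 0 ?_ hQ (E := E - X * (T * (C g * E))) (by simp) (by simpa using hTP)⟩
  rintro (_ | i) hi
  · omega
  · rw [map_add, coeff_succ_X_mul, coeff_C_mul, hP.coeff_eq_zero _ hi, hQ i (by omega), mul_zero,
      add_zero]

variable {K : Type*} [CommRing K] [Algebra K R] {S A T B : R⟦X⟧} {α : K}

theorem one_sub_smul_X_mul (α : K) (S : R⟦X⟧) : (1 - α • X) * S = S - α • (X * S) := by
  rw [sub_mul, one_mul, smul_mul_assoc]

theorem coeff_succ_one_sub_smul_X_mul (α : K) (S : R⟦X⟧) (n : ℕ) :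
    coeff (n + 1) ((1 - α • X) * S) = coeff (n + 1) S - α • coeff n S := by
  rw [one_sub_smul_X_mul, map_sub, ← coeff_succ_X_mul n S]
  rfl

theorem commute_one_sub_smul_X (α : K) (S : R⟦X⟧) : Commute S (1 - α • X) :=
  (Commute.one_right S).sub_right ((commute_X S).smul_right α)

theorem one_sub_smul_X_mul_mul {g : R} (hA : X * A = (1 - α • X) * S - C (constantCoeff S))
    (hT : T * (1 + X * (C g * A)) = A) (hTg : T * C (g * constantCoeff S) = T) :
    (1 - α • X) * T * (C g * S) = A := by
  have h : X * (C g * A) = (1 - α • X) * (C g * S) - C (g * constantCoeff S) := by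
    rw [← mul_assoc, ← (commute_X (C g)).eq, mul_assoc, hA, mul_sub, ← mul_assoc,
      (commute_one_sub_smul_X α (C g)).eq, mul_assoc, map_mul]
  rw [h, mul_add, mul_sub, hTg, mul_one, add_sub_cancel, ← mul_assoc,
    (commute_one_sub_smul_X α T).eq] at hT
  exact hT

theorem X_sq_mul_schur_denominator {P Q E : R⟦X⟧} {g : R} {n : ℕ}
    (hA : X * A = (1 - α • X) * S - C (constantCoeff S))
    (hB : X * B = (1 - α • X) * T - C (constantCoeff T))
    (hT : T * (1 + X * (C g * A)) = A) (hTg : T * C (g * constantCoeff S) = T)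
    (hSP : S * P = Q + X ^ n * E) :
    X ^ 2 * (B * (1 - C (g * constantCoeff S) + C g * Q)) =
      ((1 - α • X) * Q - C (constantCoeff S) * P - X * (C (constantCoeff T * g) * Q)) +
        X ^ n * ((1 - α • X) * E - X * ((1 - α • X) * T * (C g * E))) := by
  have hBg : B * C (g * constantCoeff S) = B := by
    have h₀ : constantCoeff T * (g * constantCoeff S) = constantCoeff T := by
      simpa using congrArg constantCoeff hTg
    refine X_mul_cancel ?_
    rw [← mul_assoc, hB, sub_mul, mul_assoc, hTg, ← map_mul, h₀]
  calc X ^ 2 * (B * (1 - C (g * constantCoeff S) + C g * Q))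
      = X * (X * B) * C g * Q := by
        rw [mul_add, mul_sub, mul_one, hBg]
        noncomm_ring
    _ = X * ((1 - α • X) * T * (C g * S)) * P - X * (C (constantCoeff T * g) * Q) -
          X * ((1 - α • X) * T * C g) * (S * P - Q) := by
        rw [hB, map_mul]
        noncomm_ring
    _ = ((1 - α • X) * Q - C (constantCoeff S) * P - X * (C (constantCoeff T * g) * Q)) +
          ((1 - α • X) * X ^ n * E - (X * ((1 - α • X) * T * C g)) * X ^ n * E) := by
        rw [one_sub_smul_X_mul_mul hA hT hTg, hA, sub_mul, mul_assoc (1 - α • X) S, hSP]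
        noncomm_ring
    _ = _ := by
        rw [(commute_X_pow (1 - α • X) _).eq, (commute_X_pow (X * _) _).eq]
        noncomm_ring

theorem HasPadeResidual.of_schur {g L : R} {n : ℕ}
    (hA : X * A = (1 - α • X) * S - C (constantCoeff S))
    (hB : X * B = (1 - α • X) * T - C (constantCoeff T))
    (hT : T * (1 + X * (C g * A)) = A) (hTg : T * C (g * constantCoeff S) = T)
    (hS : HasPadeResidual S (n + 1) L) : HasPadeResidual B n L := by
  obtain ⟨P, hP₀, hP⟩ := hS
  obtain ⟨Q, E, hQ, rfl, hSP⟩ := hP.exists_eq_add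
  have hQ₀ : constantCoeff Q = constantCoeff S := by
    simpa [hP₀, mul_add] using (congrArg constantCoeff hSP).symm
  refine ⟨1 - C (g * constantCoeff S) + C g * Q, by simp [hQ₀],
    .of_X_pow_mul_eq_add 2 (fun i hi => ?_) (fun i hi => ?_) (by simp)
      (X_sq_mul_schur_denominator hA hB hT hTg hSP)⟩
  · rw [map_add, coeff_C_mul, hQ i hi, mul_zero, map_sub, coeff_one, coeff_C,
      if_neg (by omega), if_neg (by omega), sub_zero, add_zero]
  · obtain ⟨i, rfl⟩ := Nat.exists_eq_add_of_le' (show 1 ≤ i by omega)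
    simp only [coeff_succ_one_sub_smul_X_mul, map_sub, coeff_succ_X_mul, coeff_C_mul,
      hQ i (by omega), hQ (i + 1) (by omega), hP.coeff_eq_zero (i + 1) (by omega), mul_zero,
      smul_zero, sub_zero]

end PadeResidual

section PosSemidef

variable {ι κ l : Type*} [Finite ι] [Fintype κ] {M : Matrix ι ι ℂ}

open scoped MatrixOrder in
theorem exists_submatrix_mul_eq (hM : M.PosSemidef) (e : κ → ι) (f : l → ι) :
    ∃ Y : Matrix κ l ℂ, M.submatrix e e * Y = M.submatrix e f := by
  classical
  have := Fintype.ofFinite ι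
  obtain ⟨B, rfl⟩ := CStarAlgebra.nonneg_iff_eq_star_mul_self.mp hM.nonneg
  have hB := moorePenrose_spec (B.submatrix id e)
  refine ⟨moorePenrose (B.submatrix id e) * B.submatrix id f, ?_⟩
  calc (B.submatrix id e)ᴴ * B.submatrix id e * (moorePenrose (B.submatrix id e) * B.submatrix id f)
      = (B.submatrix id e)ᴴ * (B.submatrix id e * moorePenrose (B.submatrix id e))ᴴ *
          B.submatrix id f := by simp only [hB.left_herm, Matrix.mul_assoc]
    _ = (B.submatrix id e)ᴴ * B.submatrix id f := by
      rw [← Matrix.conjTranspose_mul, hB.mul_mul_self]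

theorem submatrix_mul_eq_zero (hM : M.PosSemidef) {e : κ → ι} {p : Type*} {V : Matrix κ p ℂ}
    (hV : M.submatrix e e * V = 0) (f : l → ι) : M.submatrix f e * V = 0 := by
  obtain ⟨Y, hY⟩ := exists_submatrix_mul_eq hM e f
  rw [← hM.1.eq, ← Matrix.conjTranspose_submatrix, ← hY, Matrix.conjTranspose_mul,
    (hM.1.submatrix e).eq, Matrix.mul_assoc, hV, Matrix.mul_zero]

end PosSemidef

section BlockHankel

variable {q : ℕ} {s : ℕ → Matrix (Fin q) (Fin q) ℂ} {n : ℕ}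

theorem conjTranspose_blockHankel (hs : ∀ j ≤ 2 * n, (s j)ᴴ = s j) :
    (blockHankel s n)ᴴ = blockHankel s n := by
  ext a b
  rw [blockHankel, Matrix.conjTranspose_apply, Matrix.of_apply, Matrix.of_apply, add_comm b.1.val,
    ← Matrix.conjTranspose_apply, hs _ (by omega)]

theorem conjTranspose_eq_of_isHermitian_blockHankel (h : (blockHankel s n).IsHermitian) {j : ℕ}
    (hj : j ≤ 2 * n) : (s j)ᴴ = s j := by
  ext a b
  simpa [blockHankel, Nat.sub_add_cancel (Nat.div_le_self j 2),
    Nat.add_sub_cancel' (Nat.div_le_self j 2)] using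
    congrFun (congrFun h.eq (⟨j / 2, by omega⟩, a)) (⟨j - j / 2, by omega⟩, b)

theorem posSemidef_blockHankel_of_le {m : ℕ} (h : m ≤ n) (hn : (blockHankel s n).PosSemidef) :
    (blockHankel s m).PosSemidef :=
  hn.submatrix fun a : Fin (m + 1) × Fin q => (Fin.castLE (by omega) a.1, a.2)

theorem exists_blockHankel_mul_eq (h : (blockHankel s (n + 1)).PosSemidef) :
    ∃ Y : Matrix _ _ ℂ, blockHankel s n * Y = blockCol s (n + 1) n := by
  obtain ⟨Y, hY⟩ := exists_submatrix_mul_eq h (Prod.map Fin.castSucc id)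
    fun b : Fin q => (Fin.last (n + 1), b)
  refine ⟨Y, hY.trans ?_⟩
  ext a b
  simp [blockHankel, blockCol, add_comm]

theorem blockRow_succ_mul_eq_zero (h : (blockHankel s (n + 1)).PosSemidef) {p : Type*}
    {V : Matrix (Fin (n + 1) × Fin q) p ℂ} (hV : blockHankel s n * V = 0) :
    blockRow s (n + 1) n * V = 0 :=
  submatrix_mul_eq_zero h (e := Prod.map Fin.castSucc id) hV
    fun a : Fin q => (Fin.last (n + 1), a)

theorem blockRow_mul_blockCol {p r : ℕ} (s : ℕ → Matrix (Fin p) (Fin q) ℂ)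
    (w : ℕ → Matrix (Fin q) (Fin r) ℂ) (l m n : ℕ) :
    blockRow s l n * blockCol w m n = ∑ k ∈ range (n + 1), s (l + k) * w (m + k) := by
  ext a b
  rw [Matrix.mul_apply, Fintype.sum_prod_type, Matrix.sum_apply,
    ← Fin.sum_univ_eq_sum_range fun k => (s (l + k) * w (m + k)) a b]
  rfl

theorem conjTranspose_blockCol {p : ℕ} (w : ℕ → Matrix (Fin p) (Fin q) ℂ) (l n : ℕ) :
    (blockCol w l n)ᴴ = blockRow (fun k => (w k)ᴴ) l n := rfl

theorem blockHankel_mul_eq_blockCol_iff {p r l : ℕ} {s : ℕ → Matrix (Fin p) (Fin q) ℂ}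
    {V : Matrix (Fin (n + 1) × Fin q) (Fin r) ℂ} {w : ℕ → Matrix (Fin p) (Fin r) ℂ} :
    blockHankel s n * V = blockCol w l n ↔ ∀ i ≤ n, blockRow s i n * V = w (l + i) := by
  refine ⟨fun h i hi => ?_, fun h => ?_⟩
  · ext a b
    exact congrFun (congrFun h (⟨i, by omega⟩, a)) b
  · ext a b
    exact congrFun (congrFun (h a.1 (by omega)) a.2) b

theorem coeff_mk_mul {W : (Matrix (Fin q) (Fin q) ℂ)⟦X⟧} (hW : ∀ i, n < i → coeff i W = 0)
    (s : ℕ → Matrix (Fin q) (Fin q) ℂ) (l : ℕ) :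
    coeff (l + n) (PowerSeries.mk s * W) =
      blockRow s l n * blockCol (fun k => coeff (n - k) W) 0 n := by
  rw [coeff_mul, Nat.sum_antidiagonal_eq_sum_range_succ
      fun i j => coeff i (PowerSeries.mk s) * coeff j W,
    Nat.succ_eq_add_one, add_assoc, sum_range_add, sum_eq_zero, zero_add, blockRow_mul_blockCol]
  · refine sum_congr rfl fun k _ => ?_
    rw [coeff_mk, zero_add, Nat.add_sub_add_left]
  · intro k hk
    rw [hW _ (by have := mem_range.1 hk; omega), mul_zero]

theorem coeff_mk_mul_succ {W : (Matrix (Fin q) (Fin q) ℂ)⟦X⟧}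
    (hW : ∀ i, n + 1 < i → coeff i W = 0) (s : ℕ → Matrix (Fin q) (Fin q) ℂ) (l : ℕ) :
    coeff (l + (n + 1)) (PowerSeries.mk s * W) =
      blockRow s l n * blockCol (fun k => coeff (n + 1 - k) W) 0 n +
        s (l + (n + 1)) * constantCoeff W := by
  rw [coeff_mk_mul hW, blockRow_mul_blockCol, blockRow_mul_blockCol, sum_range_succ, zero_add,
    Nat.sub_self, coeff_zero_eq_constantCoeff_apply]

theorem isPadeDenominator_iff {W : (Matrix (Fin q) (Fin q) ℂ)⟦X⟧} {L : Matrix (Fin q) (Fin q) ℂ}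
    (hW : ∀ i, n < i → coeff i W = 0) :
    IsPadeDenominator (PowerSeries.mk s) n W L ↔
      blockHankel s n * blockCol (fun k => coeff (n - k) W) 0 n =
        blockCol (fun k => if k = n then L else 0) 0 n := by
  simp only [blockHankel_mul_eq_blockCol_iff, ← coeff_mk_mul hW, zero_add]
  refine ⟨fun h i hi => ?_, fun h => ⟨hW, fun i hi hi' => ?_, ?_⟩⟩
  · split_ifs with hin
    · rw [hin, ← two_mul, h.coeff_mul_two_mul]
    · exact h.coeff_mul_eq_zero _ (by omega) (by omega)
  · have := h (i - n) (by omega)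
    rwa [if_neg (by omega), Nat.sub_add_cancel hi] at this
  · have := h n le_rfl
    rwa [if_pos rfl, ← two_mul] at this

theorem isPadeDenominator_succ_iff {W : (Matrix (Fin q) (Fin q) ℂ)⟦X⟧}
    {L : Matrix (Fin q) (Fin q) ℂ} (hW : ∀ i, n + 1 < i → coeff i W = 0)
    (hW₀ : constantCoeff W = 1) :
    IsPadeDenominator (PowerSeries.mk s) (n + 1) W L ↔
      blockHankel s n * -blockCol (fun k => coeff (n + 1 - k) W) 0 n = blockCol s (n + 1) n ∧
        s (2 * (n + 1)) - blockRow s (n + 1) n * -blockCol (fun k => coeff (n + 1 - k) W) 0 n =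
          L := by
  have hcoeff (l : ℕ) : coeff (l + (n + 1)) (PowerSeries.mk s * W) =
      s (l + (n + 1)) - blockRow s l n * -blockCol (fun k => coeff (n + 1 - k) W) 0 n := by
    rw [coeff_mk_mul_succ hW, hW₀, mul_one, Matrix.mul_neg, sub_neg_eq_add, add_comm]
  rw [two_mul, ← hcoeff, blockHankel_mul_eq_blockCol_iff]
  refine ⟨fun h => ⟨fun i hi => ?_, by rw [← two_mul, h.coeff_mul_two_mul]⟩,
    fun h => ⟨hW, fun i hi hi' => ?_, by rw [two_mul, h.2]⟩⟩
  · rw [add_comm (n + 1) i, eq_comm, ← sub_eq_zero, ← hcoeff]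
    exact h.coeff_mul_eq_zero _ (by omega) (by omega)
  · obtain ⟨i, rfl⟩ := Nat.exists_eq_add_of_le' hi
    rw [hcoeff, h.1 i (by omega), add_comm, sub_self]

theorem exists_blockCol_coeff_eq (Y : Matrix (Fin (n + 1) × Fin q) (Fin q) ℂ) :
    ∃ W : (Matrix (Fin q) (Fin q) ℂ)⟦X⟧, (∀ i, n + 1 < i → coeff i W = 0) ∧
      constantCoeff W = 1 ∧ blockCol (fun k => coeff (n + 1 - k) W) 0 n = Y := by
  refine ⟨PowerSeries.mk fun i => if i = 0 then 1 else if i ≤ n + 1 then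
    Matrix.of fun a b => Y (⟨n - (i - 1), by omega⟩, a) b else 0, fun i hi => ?_, by simp, ?_⟩
  · rw [coeff_mk, if_neg (by omega), if_neg (by omega)]
  · ext ⟨k, a⟩ b
    simp only [blockCol, coeff_mk, Matrix.of_apply, zero_add]
    rw [if_neg (by omega), if_pos (by omega), Matrix.of_apply]
    congr
    omega

theorem hasPadeResidual_schurComplement_succ {Y : Matrix (Fin (n + 1) × Fin q) (Fin q) ℂ}
    (hY : blockHankel s n * Y = blockCol s (n + 1) n) :
    HasPadeResidual (PowerSeries.mk s) (n + 1) (schurComplement s (n + 1)) := by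
  obtain ⟨W, hW, hW₀, hWY⟩ :=
    exists_blockCol_coeff_eq (-(moorePenrose (blockHankel s n) * blockCol s (n + 1) n))
  refine ⟨W, hW₀, (isPadeDenominator_succ_iff hW hW₀).2 ?_⟩
  rw [hWY, neg_neg, schurComplement, Matrix.mul_assoc]
  refine ⟨?_, rfl⟩
  rw [← hY, ← Matrix.mul_assoc, ← Matrix.mul_assoc, (moorePenrose_spec _).mul_mul_self]

theorem HasPadeResidual.schurComplement {L : Matrix (Fin q) (Fin q) ℂ}
    (h : HasPadeResidual (PowerSeries.mk s) n L) :
    HasPadeResidual (PowerSeries.mk s) n (schurComplement s n) := by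
  obtain _ | n := n
  · simpa [StieltjesSchur.schurComplement] using hasPadeResidual_zero (PowerSeries.mk s)
  · obtain ⟨W, hW₀, hW⟩ := h
    exact hasPadeResidual_schurComplement_succ
      ((isPadeDenominator_succ_iff hW.coeff_eq_zero hW₀).1 hW).1

theorem hasPadeResidual_schurComplement (h : (blockHankel s n).PosSemidef) :
    HasPadeResidual (PowerSeries.mk s) n (schurComplement s n) := by
  obtain _ | n := n
  · exact (hasPadeResidual_zero _).schurComplement
  · obtain ⟨Y, hY⟩ := exists_blockHankel_mul_eq h
    exact hasPadeResidual_schurComplement_succ hY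

theorem IsPadeDenominator.conjTranspose_residual_mul {V W : (Matrix (Fin q) (Fin q) ℂ)⟦X⟧}
    {K L : Matrix (Fin q) (Fin q) ℂ} (hs : ∀ j ≤ 2 * n, (s j)ᴴ = s j)
    (hV : IsPadeDenominator (PowerSeries.mk s) n V K)
    (hW : IsPadeDenominator (PowerSeries.mk s) n W L) :
    Kᴴ * constantCoeff W = (constantCoeff V)ᴴ * L := by
  -- Both sides compute `v* H_n w` for the block columns `v` and `w` that encode `V` and `W`.
  have key := congrArg (· * blockCol (fun k => coeff (n - k) W) 0 n) <|
    congrArg Matrix.conjTranspose ((isPadeDenominator_iff hV.coeff_eq_zero).1 hV)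
  simp only [Matrix.conjTranspose_mul, conjTranspose_blockHankel hs, Matrix.mul_assoc,
    (isPadeDenominator_iff hW.coeff_eq_zero).1 hW, conjTranspose_blockCol,
    blockRow_mul_blockCol, sum_range_succ] at key
  rw [sum_eq_zero, sum_eq_zero] at key
  · simpa using key.symm
  · intro k hk
    rw [if_neg (by have := mem_range.1 hk; omega), Matrix.conjTranspose_zero, zero_mul]
  · intro k hk
    rw [if_neg (by have := mem_range.1 hk; omega), mul_zero]

theorem HasPadeResidual.schurComplement_eq {L : Matrix (Fin q) (Fin q) ℂ}
    (hs : ∀ j ≤ 2 * n, (s j)ᴴ = s j) (h : HasPadeResidual (PowerSeries.mk s) n L) :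
    StieltjesSchur.schurComplement s n = L := by
  obtain ⟨V, hV₀, hV⟩ := h.schurComplement
  obtain ⟨W, hW₀, hW⟩ := h
  have h₁ := hV.conjTranspose_residual_mul hs hV
  have h₂ := hV.conjTranspose_residual_mul hs hW
  simp only [hV₀, hW₀, Matrix.conjTranspose_one, mul_one, one_mul] at h₁ h₂
  exact h₁.symm.trans h₂

theorem IsPadeDenominator.schurComplement_mul_constantCoeff
    {W : (Matrix (Fin q) (Fin q) ℂ)⟦X⟧} (h : (blockHankel s n).PosSemidef)
    (hW : IsPadeDenominator (PowerSeries.mk s) n W 0) :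
    schurComplement s n * constantCoeff W = 0 := by
  have hs (j) (hj : j ≤ 2 * n) := conjTranspose_eq_of_isHermitian_blockHankel h.1 hj
  obtain ⟨V, hV₀, hV⟩ := hasPadeResidual_schurComplement h
  have h₁ := hV.conjTranspose_residual_mul hs hV
  have h₂ := hV.conjTranspose_residual_mul hs hW
  rw [hV₀, mul_one, Matrix.conjTranspose_one, one_mul] at h₁
  rwa [h₁, mul_zero] at h₂

theorem IsPadeDenominator.coeff_two_mul_add_one_mul {W : (Matrix (Fin q) (Fin q) ℂ)⟦X⟧}
    (h : (blockHankel s (n + 1)).PosSemidef) (hW : IsPadeDenominator (PowerSeries.mk s) n W 0) :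
    coeff (2 * n + 1) (PowerSeries.mk s * W) = 0 := by
  rw [show 2 * n + 1 = n + 1 + n by ring, coeff_mk_mul hW.coeff_eq_zero]
  refine blockRow_succ_mul_eq_zero h (((isPadeDenominator_iff hW.coeff_eq_zero).1 hW).trans ?_)
  ext a b
  simp [blockCol]

end BlockHankel

section NullDenominator

variable {R : Type*} [Ring R] {K : Type*} [CommRing K] [Algebra K R] {S A W : R⟦X⟧} {α : K} {n : ℕ}

theorem IsPadeDenominator.coeff_mul_eq_zero_of_le (h : IsPadeDenominator S n W 0)
    (h' : coeff (2 * n + 1) (S * W) = 0) {i : ℕ} (hi : n ≤ i) (hi' : i ≤ 2 * n + 1) :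
    coeff i (S * W) = 0 := by
  rcases Nat.lt_trichotomy i (2 * n) with hlt | rfl | hgt
  · exact h.coeff_mul_eq_zero i hi hlt
  · exact h.coeff_mul_two_mul
  · rwa [show i = 2 * n + 1 by omega]

theorem IsPadeDenominator.shift_zero (hA : X * A = (1 - α • X) * S - C (constantCoeff S))
    (h : IsPadeDenominator S n W 0) (h' : coeff (2 * n + 1) (S * W) = 0) :
    IsPadeDenominator A n W 0 := by
  have hAW {i} (hi : n ≤ i) (hi' : i ≤ 2 * n) : coeff i (A * W) = 0 := by
    rw [← coeff_succ_X_mul, ← mul_assoc, hA, sub_mul, mul_assoc, map_sub,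
      coeff_succ_one_sub_smul_X_mul, coeff_C_mul, h.coeff_mul_eq_zero_of_le h' hi (by omega),
      h.coeff_mul_eq_zero_of_le h' (by omega) (by omega), h.coeff_eq_zero _ (by omega), smul_zero,
      mul_zero, sub_zero, sub_zero]
  exact ⟨h.coeff_eq_zero, fun i hi hi' => hAW hi hi'.le, hAW (by omega) le_rfl⟩

theorem IsPadeDenominator.unshift_zero (hA : X * A = (1 - α • X) * S - C (constantCoeff S))
    (h : IsPadeDenominator A n W 0) (h' : coeff (2 * n + 1) (A * W) = 0) :
    IsPadeDenominator S (n + 1) ((1 - α • X) * W) 0 := by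
  have hSW {i} (hi : n ≤ i) (hi' : i ≤ 2 * n + 1) :
      coeff (i + 1) (S * ((1 - α • X) * W)) = 0 := by
    rw [← mul_assoc, (commute_one_sub_smul_X α S).eq, ← sub_add_cancel ((1 - α • X) * S),
      ← hA, add_mul, mul_assoc, map_add, coeff_succ_X_mul, h.coeff_mul_eq_zero_of_le h' hi hi',
      coeff_C_mul, h.coeff_eq_zero _ (by omega), mul_zero, add_zero]
  refine ⟨fun i hi => ?_, fun i hi hi' => ?_, hSW (i := 2 * n + 1) (by omega) le_rfl⟩
  all_goals obtain ⟨i, rfl⟩ := Nat.exists_eq_add_of_le' (show 1 ≤ i by omega)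
  · rw [coeff_succ_one_sub_smul_X_mul, h.coeff_eq_zero _ (by omega), h.coeff_eq_zero _ (by omega),
      smul_zero, sub_zero]
  · exact hSW (by omega) (by omega)

end NullDenominator

section Reciprocal

variable {R : Type*} [Ring R] {A V T : R⟦X⟧} {a g : R}

theorem isUnit_one_add_X_mul (F : R⟦X⟧) : IsUnit (1 + X * F) := by
  simp [isUnit_iff_constantCoeff]

theorem mul_one_add_X_mul (hV : (1 + X * (C g * A)) * V = C g) :
    V * (1 + X * (A * C g)) = C g := by
  refine (isUnit_one_add_X_mul (C g * A)).mul_left_cancel ?_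
  rw [← mul_assoc, hV, mul_add, add_mul, mul_one, one_mul, ← mul_assoc (C g) X,
    (commute_X (C g)).eq, mul_assoc, mul_assoc, mul_assoc]

theorem C_mul_one_add_X_mul (hl : C (a * g) * A = A) (hr : A * C (g * a) = A) :
    C a * (1 + X * (C g * A)) = (1 + X * (A * C g)) * C a := by
  rw [map_mul] at hl hr
  rw [mul_add, add_mul, mul_one, one_mul, ← mul_assoc (C a) X, (commute_X (C a)).eq, mul_assoc,
    ← mul_assoc (C a), hl, mul_assoc, mul_assoc, hr]

theorem mul_one_add_X_mul_eq (hg : a * g * a = a) (hV : (1 + X * (C g * A)) * V = C g)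
    (hT : X * T = C a - C a * V * C a) (hl : C (a * g) * A = A) (hr : A * C (g * a) = A) :
    T * (1 + X * (C g * A)) = A := by
  refine X_mul_cancel ?_
  calc X * (T * (1 + X * (C g * A)))
      = C a * (1 + X * (C g * A)) - C a * V * (C a * (1 + X * (C g * A))) := by
        rw [← mul_assoc, hT, sub_mul]
        noncomm_ring
    _ = C a + C a * X * C g * A - C a * (V * (1 + X * (A * C g))) * C a := by
        nth_rw 2 [C_mul_one_add_X_mul hl hr]
        noncomm_ring
    _ = C a + X * (C (a * g) * A) - C (a * g * a) := by
        rw [mul_one_add_X_mul hV, (commute_X (C a)).eq, map_mul, map_mul, map_mul]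
        noncomm_ring
    _ = X * A := by rw [hl, hg, add_sub_cancel_left]

theorem one_add_X_mul_mul_eq (hg : a * g * a = a) (hV : (1 + X * (C g * A)) * V = C g)
    (hT : X * T = C a - C a * V * C a) (hl : C (a * g) * A = A) (hr : A * C (g * a) = A) :
    (1 + X * (A * C g)) * T = A := by
  refine X_mul_cancel ?_
  calc X * ((1 + X * (A * C g)) * T)
      = (1 + X * (A * C g)) * (X * T) := by
        rw [← mul_assoc, ← (commute_X _).eq, mul_assoc]
    _ = (1 + X * (A * C g)) * C a - ((1 + X * (A * C g)) * C a) * V * C a := by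
        rw [hT]
        noncomm_ring
    _ = C a + X * (A * (C g * C a)) - C a * ((1 + X * (C g * A)) * V) * C a := by
        rw [← C_mul_one_add_X_mul hl hr]
        nth_rw 1 [C_mul_one_add_X_mul hl hr]
        noncomm_ring
    _ = X * A := by
        rw [hV, ← map_mul, hr, ← map_mul, ← map_mul, hg, add_sub_cancel_left]

/-- The power series whose coefficients are the adjoints of those of `φ`. -/
noncomputable def starSeries [StarRing R] (φ : R⟦X⟧) : R⟦X⟧ :=
  PowerSeries.mk fun n => star (coeff n φ)

theorem starSeries_mul [StarRing R] (φ ψ : R⟦X⟧) :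
    starSeries (φ * ψ) = starSeries ψ * starSeries φ := by
  ext n
  simp only [starSeries, coeff_mk, coeff_mul, star_sum, star_mul]
  exact Nat.sum_antidiagonal_swap (f := fun p => star (coeff p.1 ψ) * star (coeff p.2 φ))

theorem starSeries_C [StarRing R] (g : R) : starSeries (C g) = C (star g) := by
  ext n
  rw [starSeries, coeff_mk, coeff_C, coeff_C, apply_ite star, star_zero]

theorem starSeries_one_add_X_mul [StarRing R] (φ : R⟦X⟧) :
    starSeries (1 + X * φ) = 1 + X * starSeries φ := by
  ext (_ | n) <;> simp [starSeries, coeff_succ_X_mul, coeff_one]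

theorem starSeries_eq_self [StarRing R] (hg : star g = g) (hA : starSeries A = A)
    (hT : T * (1 + X * (C g * A)) = A) (hT' : (1 + X * (A * C g)) * T = A) :
    starSeries T = T := by
  refine (isUnit_one_add_X_mul (C g * A)).mul_right_cancel ?_
  have := congrArg starSeries hT'
  rw [starSeries_mul, starSeries_one_add_X_mul, starSeries_mul, starSeries_C, hg, hA] at this
  exact this.trans hT.symm

end Reciprocal

section SchurStep

variable {q : ℕ}

section Rectangular

variable {p : ℕ} {s s' : ℕ → Matrix (Fin p) (Fin q) ℂ} {α : ℂ}

theorem moorePenrose_conjTranspose {m n : Type*} [Fintype m] [Fintype n] (A : Matrix m n ℂ) :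
    moorePenrose Aᴴ = (moorePenrose A)ᴴ := by
  have h := moorePenrose_spec A
  refine (moorePenrose_spec Aᴴ).unique ⟨?_, ?_, ?_, ?_⟩
  · simpa only [Matrix.conjTranspose_mul, Matrix.mul_assoc] using
      congrArg Matrix.conjTranspose h.mul_mul_self
  · simpa only [Matrix.conjTranspose_mul, Matrix.mul_assoc] using
      congrArg Matrix.conjTranspose h.self_mul_mul
  · rw [← Matrix.conjTranspose_mul, h.right_herm, h.right_herm]
  · rw [← Matrix.conjTranspose_mul, h.left_herm, h.left_herm]

theorem alphaShift_congr {j : ℕ} (h : s j = s' j) (h' : s (j + 1) = s' (j + 1)) :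
    alphaShift α s j = alphaShift α s' j := by
  rw [alphaShift, alphaShift, h, h']

theorem alphaShift_mul {ι : Type*} (α : ℂ) (s : ℕ → Matrix (Fin p) (Fin q) ℂ) (j : ℕ)
    (M : Matrix (Fin q) ι ℂ) :
    alphaShift α s j * M = -(α • (s j * M)) + s (j + 1) * M := by
  rw [alphaShift, Matrix.add_mul, Matrix.neg_mul, Matrix.smul_mul]

theorem reciprocalSeq_congr {j : ℕ} (h : ∀ i ≤ j, s i = s' i) :
    reciprocalSeq s j = reciprocalSeq s' j := by
  induction j using Nat.strong_induction_on with
  | _ j ih =>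
    obtain _ | j := j
    · rw [reciprocalSeq, reciprocalSeq, h 0 le_rfl]
    · rw [reciprocalSeq, reciprocalSeq, h 0 (by omega)]
      congr 2
      refine sum_congr rfl fun l _ => ?_
      rw [h _ (by omega), ih l (by omega) fun i hi => h i (by omega)]

theorem plusTransform_congr {j : ℕ} (h : ∀ i ≤ j, s i = s' i) :
    plusTransform α s j = plusTransform α s' j := by
  obtain _ | j := j
  · exact h 0 le_rfl
  · exact alphaShift_congr (h j (by omega)) (h (j + 1) le_rfl)

theorem schurStep_congr {j : ℕ} (h : ∀ i ≤ j + 1, s i = s' i) :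
    schurStep α s j = schurStep α s' j := by
  rw [schurStep, schurStep, h 0 (by omega),
    reciprocalSeq_congr fun i hi => plusTransform_congr fun l hl => h l (by omega)]

end Rectangular

variable {s : ℕ → Matrix (Fin q) (Fin q) ℂ}

theorem X_mul_mk_alphaShift (α : ℂ) (s : ℕ → Matrix (Fin q) (Fin q) ℂ) :
    X * PowerSeries.mk (alphaShift α s) =
      (1 - α • X) * PowerSeries.mk s - C (constantCoeff (PowerSeries.mk s)) := by
  ext1 (_ | n)
  · simp
  · rw [coeff_succ_X_mul, map_sub, coeff_succ_one_sub_smul_X_mul, coeff_succ_C, coeff_mk, coeff_mk,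
      coeff_mk, sub_zero, alphaShift, neg_add_eq_sub]

theorem one_add_X_mul_mul_mk_reciprocalSeq (u : ℕ → Matrix (Fin q) (Fin q) ℂ) :
    (1 + X * (C (moorePenrose (u 0)) * PowerSeries.mk fun j => u (j + 1))) *
      PowerSeries.mk (reciprocalSeq u) = C (moorePenrose (u 0)) := by
  ext1 (_ | n)
  · simp [reciprocalSeq]
  · rw [add_mul, one_mul, mul_assoc, mul_assoc, map_add, coeff_succ_X_mul, coeff_C_mul, coeff_mk,
      reciprocalSeq, coeff_succ_C, neg_add_eq_zero, coeff_mul,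
      Fin.sum_univ_eq_sum_range fun l => u (n + 1 - l) * reciprocalSeq u l,
      ← Nat.sum_antidiagonal_swap]
    simp only [Prod.fst_swap, Prod.snd_swap, coeff_mk]
    rw [Nat.sum_antidiagonal_eq_sum_range_succ fun l i => u (i + 1) * reciprocalSeq u l]
    refine congrArg _ (sum_congr rfl fun l hl => ?_)
    rw [Nat.succ_sub (mem_range_succ_iff.1 hl)]

theorem X_mul_mk_schurStep (α : ℂ) (s : ℕ → Matrix (Fin q) (Fin q) ℂ) :
    X * PowerSeries.mk (schurStep α s) =
      C (s 0) - C (s 0) * PowerSeries.mk (reciprocalSeq (plusTransform α s)) * C (s 0) := by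
  ext1 (_ | n)
  · simp [reciprocalSeq, plusTransform, (moorePenrose_spec (s 0)).mul_mul_self]
  · rw [coeff_succ_X_mul, coeff_mk, schurStep, map_sub, coeff_succ_C, coeff_mul_C, coeff_C_mul,
      coeff_mk, zero_sub, mul_neg, neg_mul]

theorem mk_schurStep_mul (α : ℂ) (s : ℕ → Matrix (Fin q) (Fin q) ℂ) :
    PowerSeries.mk (schurStep α s) * C (moorePenrose (s 0) * s 0) =
      PowerSeries.mk (schurStep α s) := by
  ext1 n
  rw [coeff_mul_C, coeff_mk, schurStep, mul_assoc, ← mul_assoc (s 0),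
    (moorePenrose_spec (s 0)).mul_mul_self]

theorem mk_alphaShift_mul (hr : ∀ j, s j * (moorePenrose (s 0) * s 0) = s j) (α : ℂ) :
    PowerSeries.mk (alphaShift α s) * C (moorePenrose (s 0) * s 0) =
      PowerSeries.mk (alphaShift α s) := by
  ext1 n
  rw [coeff_mul_C, coeff_mk, alphaShift_mul, hr, hr, alphaShift]

variable {α : ℝ}

theorem conjTranspose_alphaShift {j : ℕ} (h : (s j)ᴴ = s j)
    (h' : (s (j + 1))ᴴ = s (j + 1)) :
    (alphaShift (α : ℂ) s j)ᴴ = alphaShift (α : ℂ) s j := by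
  simp [alphaShift, h, h', Matrix.conjTranspose_smul]

theorem starSeries_mk_eq_self (hs : ∀ j, (s j)ᴴ = s j) :
    starSeries (PowerSeries.mk s) = PowerSeries.mk s := by
  ext1 n
  rw [starSeries, coeff_mk, coeff_mk, Matrix.star_eq_conjTranspose, hs]

theorem starSeries_mk_alphaShift (hs : ∀ j, (s j)ᴴ = s j) :
    starSeries (PowerSeries.mk (alphaShift (α : ℂ) s)) = PowerSeries.mk (alphaShift (α : ℂ) s) :=
  starSeries_mk_eq_self fun j => conjTranspose_alphaShift (hs j) (hs (j + 1))

theorem C_mul_mk_alphaShift (hs : ∀ j, (s j)ᴴ = s j)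
    (hr : ∀ j, s j * (moorePenrose (s 0) * s 0) = s j) :
    C (s 0 * moorePenrose (s 0)) * PowerSeries.mk (alphaShift (α : ℂ) s) =
      PowerSeries.mk (alphaShift (α : ℂ) s) := by
  have hstar : star (moorePenrose (s 0) * s 0) = s 0 * moorePenrose (s 0) := by
    rw [star_mul, Matrix.star_eq_conjTranspose, Matrix.star_eq_conjTranspose, hs,
      ← moorePenrose_conjTranspose, hs]
  simpa only [starSeries_mul, starSeries_C, starSeries_mk_alphaShift hs, hstar] using
    congrArg starSeries (mk_alphaShift_mul hr (α : ℂ))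

theorem mk_schurStep_mul_one_add (hs : ∀ j, (s j)ᴴ = s j)
    (hr : ∀ j, s j * (moorePenrose (s 0) * s 0) = s j) :
    PowerSeries.mk (schurStep (α : ℂ) s) *
        (1 + X * (C (moorePenrose (s 0)) * PowerSeries.mk (alphaShift (α : ℂ) s))) =
      PowerSeries.mk (alphaShift (α : ℂ) s) :=
  mul_one_add_X_mul_eq (moorePenrose_spec (s 0)).mul_mul_self
    (one_add_X_mul_mul_mk_reciprocalSeq (plusTransform (α : ℂ) s)) (X_mul_mk_schurStep _ s)
    (C_mul_mk_alphaShift hs hr) (mk_alphaShift_mul hr _)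

theorem conjTranspose_schurStep (hs : ∀ j, (s j)ᴴ = s j)
    (hr : ∀ j, s j * (moorePenrose (s 0) * s 0) = s j) (j : ℕ) :
    (schurStep (α : ℂ) s j)ᴴ = schurStep (α : ℂ) s j := by
  have hg : (moorePenrose (s 0))ᴴ = moorePenrose (s 0) := by rw [← moorePenrose_conjTranspose, hs]
  have h := starSeries_eq_self hg (starSeries_mk_alphaShift hs)
    (mk_schurStep_mul_one_add hs hr)
    (one_add_X_mul_mul_eq (moorePenrose_spec (s 0)).mul_mul_self
      (one_add_X_mul_mul_mk_reciprocalSeq (plusTransform (α : ℂ) s)) (X_mul_mk_schurStep _ s)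
      (C_mul_mk_alphaShift hs hr) (mk_alphaShift_mul hr _))
  simpa only [starSeries, coeff_mk, Matrix.star_eq_conjTranspose] using congrArg (coeff j) h

theorem HasPadeResidual.schurStep (hs : ∀ j, (s j)ᴴ = s j)
    (hr : ∀ j, s j * (moorePenrose (s 0) * s 0) = s j) {n : ℕ} {L : Matrix (Fin q) (Fin q) ℂ}
    (h : HasPadeResidual (PowerSeries.mk (alphaShift (α : ℂ) s)) n L) :
    HasPadeResidual (PowerSeries.mk (schurStep (α : ℂ) s)) n L :=
  h.of_mul_one_add (mk_schurStep_mul_one_add hs hr)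

theorem HasPadeResidual.alphaShift_schurStep (hs : ∀ j, (s j)ᴴ = s j)
    (hr : ∀ j, s j * (moorePenrose (s 0) * s 0) = s j) {n : ℕ} {L : Matrix (Fin q) (Fin q) ℂ}
    (h : HasPadeResidual (PowerSeries.mk s) (n + 1) L) :
    HasPadeResidual (PowerSeries.mk (alphaShift (α : ℂ) (StieltjesSchur.schurStep (α : ℂ) s)))
      n L :=
  h.of_schur (X_mul_mk_alphaShift _ _) (X_mul_mk_alphaShift _ _) (mk_schurStep_mul_one_add hs hr)
    (by simpa using mk_schurStep_mul (α : ℂ) s)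

end SchurStep

section Stieltjes

variable {p q : ℕ}

section Rectangular

variable {s s' : ℕ → Matrix (Fin p) (Fin q) ℂ}

theorem stieltjesParam_two_mul (α : ℂ) (s : ℕ → Matrix (Fin p) (Fin q) ℂ) (n : ℕ) :
    stieltjesParam α s (2 * n) = schurComplement s n := by
  rw [stieltjesParam, if_pos (even_two_mul n), Nat.mul_div_cancel_left n two_pos]

theorem stieltjesParam_two_mul_add_one (α : ℂ) (s : ℕ → Matrix (Fin p) (Fin q) ℂ) (n : ℕ) :
    stieltjesParam α s (2 * n + 1) = schurComplement (alphaShift α s) n := by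
  rw [stieltjesParam, if_neg (by simp), show (2 * n + 1) / 2 = n by omega]

theorem schurComplement_congr {n : ℕ} (h : ∀ j ≤ 2 * n, s j = s' j) :
    schurComplement s n = schurComplement s' n := by
  obtain _ | n := n
  · exact h 0 le_rfl
  · have hH : blockHankel s n = blockHankel s' n := by
      ext a b
      rw [blockHankel, blockHankel, Matrix.of_apply, Matrix.of_apply, h _ (by omega)]
    have hR : blockRow s (n + 1) n = blockRow s' (n + 1) n := by
      ext a b
      rw [blockRow, blockRow, Matrix.of_apply, Matrix.of_apply, h _ (by omega)]
    have hC : blockCol s (n + 1) n = blockCol s' (n + 1) n := by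
      ext a b
      rw [blockCol, blockCol, Matrix.of_apply, Matrix.of_apply, h _ (by omega)]
    rw [schurComplement, schurComplement, hH, hR, hC, h _ le_rfl]

theorem stieltjesParam_congr {α : ℂ} {j : ℕ} (h : ∀ i ≤ j, s i = s' i) :
    stieltjesParam α s j = stieltjesParam α s' j := by
  obtain ⟨n, rfl | rfl⟩ := Nat.even_or_odd' j
  · rw [stieltjesParam_two_mul, stieltjesParam_two_mul, schurComplement_congr h]
  · rw [stieltjesParam_two_mul_add_one, stieltjesParam_two_mul_add_one]
    exact schurComplement_congr fun i hi => alphaShift_congr (h i (by omega)) (h (i + 1) (by omega))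

theorem schurComplement_mul {ι : Type*} {M : Matrix (Fin q) ι ℂ} {n : ℕ}
    (h : ∀ j < 2 * n, s j * M = 0) : schurComplement s n * M = s (2 * n) * M := by
  obtain _ | n := n
  · rfl
  · have hC : blockCol s (n + 1) n * M = 0 := by
      ext a b
      exact congrFun (congrFun (h (n + 1 + a.1) (by omega)) a.2) b
    rw [schurComplement, Matrix.sub_mul, Matrix.mul_assoc, hC, Matrix.mul_zero, sub_zero]

theorem mul_eq_zero_of_stieltjesParam_mul_eq_zero {ι : Type*} {M : Matrix (Fin q) ι ℂ} {α : ℂ}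
    {j : ℕ} (h : ∀ i ≤ j, stieltjesParam α s i * M = 0) : s j * M = 0 := by
  induction j using Nat.strong_induction_on with
  | _ j ih =>
    replace ih (i) (hi : i < j) : s i * M = 0 := ih i hi fun l hl => h l (by omega)
    have hj := h j le_rfl
    obtain ⟨n, rfl | rfl⟩ := Nat.even_or_odd' j
    · rwa [stieltjesParam_two_mul, schurComplement_mul ih] at hj
    · have hA (i) (hi : i < 2 * n) : alphaShift α s i * M = 0 := by
        rw [alphaShift_mul, ih i (by omega), ih (i + 1) (by omega), smul_zero, neg_zero, add_zero]
      rwa [stieltjesParam_two_mul_add_one, schurComplement_mul hA, alphaShift_mul,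
        ih (2 * n) (by omega), smul_zero, neg_zero, zero_add] at hj

end Rectangular

variable {s s' : ℕ → Matrix (Fin q) (Fin q) ℂ} {α : ℝ} {m : ℕ}

/-- The algebraic properties of an extendable `α`-Stieltjes non-negative definite sequence
`(s_j)_{j=0}^m` that its first `α`-Schur–Stieltjes transform is shown to inherit: they take the
place of non-negative definiteness when the transform is iterated. -/
structure IsStieltjesRegular (α : ℝ) (m : ℕ) (s : ℕ → Matrix (Fin q) (Fin q) ℂ) : Prop where
  conjTranspose_eq : ∀ j ≤ m, (s j)ᴴ = s j
  hasPadeResidual_even : ∀ n, 2 * n ≤ m →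
    HasPadeResidual (PowerSeries.mk s) n (stieltjesParam (α : ℂ) s (2 * n))
  hasPadeResidual_odd : ∀ n, 2 * n + 1 ≤ m →
    HasPadeResidual (PowerSeries.mk (alphaShift (α : ℂ) s)) n
      (stieltjesParam (α : ℂ) s (2 * n + 1))
  stieltjesParam_succ_mul : ∀ j < m, ∀ M, stieltjesParam (α : ℂ) s j * M = 0 →
    stieltjesParam (α : ℂ) s (j + 1) * M = 0

theorem IsStieltjesRegular.stieltjesParam_mul (h : IsStieltjesRegular α m s)
    {M : Matrix (Fin q) (Fin q) ℂ} (hM : s 0 * M = 0) {j : ℕ} (hj : j ≤ m) :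
    stieltjesParam (α : ℂ) s j * M = 0 := by
  induction j with
  | zero => exact hM
  | succ j ih => exact h.stieltjesParam_succ_mul j hj M (ih (by omega))

theorem IsStieltjesRegular.mul_moorePenrose_mul (h : IsStieltjesRegular α m s) {j : ℕ}
    (hj : j ≤ m) : s j * (moorePenrose (s 0) * s 0) = s j := by
  have hM : s 0 * (1 - moorePenrose (s 0) * s 0) = 0 := by
    rw [mul_sub, mul_one, ← mul_assoc, (moorePenrose_spec (s 0)).mul_mul_self, sub_self]
  have hj₀ := mul_eq_zero_of_stieltjesParam_mul_eq_zero fun i hi =>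
    h.stieltjesParam_mul hM (hi.trans hj)
  rwa [mul_sub, mul_one, sub_eq_zero, eq_comm] at hj₀

theorem IsStieltjesRegular.congr (hs : IsStieltjesRegular α m s) (h : ∀ j ≤ m, s j = s' j) :
    IsStieltjesRegular α m s' := by
  have hQ (j) (hj : j ≤ m) : stieltjesParam (α : ℂ) s j = stieltjesParam (α : ℂ) s' j :=
    stieltjesParam_congr fun i hi => h i (hi.trans hj)
  refine ⟨fun j hj => ?_, fun n hn => ?_, fun n hn => ?_, fun j hj M hM => ?_⟩
  · rw [← h j hj, hs.conjTranspose_eq j hj]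
  · rw [← hQ _ hn]
    exact (hs.hasPadeResidual_even n hn).congr fun i hi => by
      rw [coeff_mk, coeff_mk, h i (by omega)]
  · rw [← hQ _ hn]
    exact (hs.hasPadeResidual_odd n hn).congr fun i hi => by
      rw [coeff_mk, coeff_mk, alphaShift_congr (h i (by omega)) (h (i + 1) (by omega))]
  · rw [← hQ _ hj.le] at hM
    rw [← hQ _ hj, hs.stieltjesParam_succ_mul j hj M hM]

theorem IsStieltjesRegular.schurStep_of_forall (h : IsStieltjesRegular α (m + 1) s)
    (hs : ∀ j, (s j)ᴴ = s j) (hr : ∀ j, s j * (moorePenrose (s 0) * s 0) = s j) :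
    IsStieltjesRegular α m (schurStep (α : ℂ) s) ∧
      ∀ j ≤ m, stieltjesParam (α : ℂ) (schurStep (α : ℂ) s) j =
        stieltjesParam (α : ℂ) s (j + 1) := by
  have ht := conjTranspose_schurStep (α := α) hs hr
  have heven (n) (hn : 2 * n ≤ m) := (h.hasPadeResidual_odd n (by omega)).schurStep hs hr
  have hodd (n) (hn : 2 * n + 1 ≤ m) :=
    (h.hasPadeResidual_even (n + 1) (by omega)).alphaShift_schurStep (α := α) hs hr
  have hQ (j) (hj : j ≤ m) : stieltjesParam (α : ℂ) (schurStep (α : ℂ) s) j =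
      stieltjesParam (α : ℂ) s (j + 1) := by
    obtain ⟨n, rfl | rfl⟩ := Nat.even_or_odd' j
    · rw [stieltjesParam_two_mul, (heven n hj).schurComplement_eq fun i _ => ht i]
    · rw [stieltjesParam_two_mul_add_one, (hodd n hj).schurComplement_eq fun i _ =>
        conjTranspose_alphaShift (ht i) (ht (i + 1))]
      rfl
  refine ⟨⟨fun j _ => ht j, fun n hn => ?_, fun n hn => ?_, fun j hj M hM => ?_⟩, hQ⟩
  · rw [hQ _ hn]
    exact heven n hn
  · rw [hQ _ hn]
    exact hodd n hn
  · rw [hQ _ hj.le] at hM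
    rw [hQ _ hj, h.stieltjesParam_succ_mul (j + 1) (by omega) M hM]

theorem IsStieltjesRegular.schurStep (h : IsStieltjesRegular α (m + 1) s) :
    IsStieltjesRegular α m (schurStep (α : ℂ) s) ∧
      ∀ j ≤ m, stieltjesParam (α : ℂ) (StieltjesSchur.schurStep (α : ℂ) s) j =
        stieltjesParam (α : ℂ) s (j + 1) := by
  -- Truncate, so that the properties of `s_0, …, s_{m+1}` hold for a whole power series.
  let s' : ℕ → Matrix (Fin q) (Fin q) ℂ := fun j => if j ≤ m + 1 then s j else 0
  have hss' (j) (hj : j ≤ m + 1) : s j = s' j := (if_pos hj).symm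
  have hs'₀ (j) (hj : ¬j ≤ m + 1) : s' j = 0 := if_neg hj
  have hs (j) : (s' j)ᴴ = s' j := by
    by_cases hj : j ≤ m + 1
    · rw [← hss' j hj, h.conjTranspose_eq j hj]
    · rw [hs'₀ j hj, Matrix.conjTranspose_zero]
  have hr (j) : s' j * (moorePenrose (s' 0) * s' 0) = s' j := by
    by_cases hj : j ≤ m + 1
    · rw [← hss' j hj, ← hss' 0 (by omega), h.mul_moorePenrose_mul hj]
    · rw [hs'₀ j hj, zero_mul]
  have ht (j) (hj : j ≤ m) :
      StieltjesSchur.schurStep (α : ℂ) s j = StieltjesSchur.schurStep (α : ℂ) s' j :=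
    schurStep_congr fun i hi => hss' i (by omega)
  obtain ⟨hreg, hQ⟩ := (h.congr hss').schurStep_of_forall hs hr
  refine ⟨hreg.congr fun j hj => (ht j hj).symm, fun j hj => ?_⟩
  rw [stieltjesParam_congr fun i hi => ht i (hi.trans hj), hQ j hj,
    stieltjesParam_congr fun i hi => (hss' i (by omega)).symm]

theorem IsStieltjesRegular.schurTransform {k : ℕ} (h : IsStieltjesRegular α (k + m) s) :
    IsStieltjesRegular α m (schurTransform (α : ℂ) s k) ∧
      ∀ j ≤ m, stieltjesParam (α : ℂ) (StieltjesSchur.schurTransform (α : ℂ) s k) j =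
        stieltjesParam (α : ℂ) s (k + j) := by
  induction k generalizing m with
  | zero =>
    rw [zero_add] at h
    exact ⟨h, fun j _ => by rw [zero_add, StieltjesSchur.schurTransform]⟩
  | succ k ih =>
    obtain ⟨hk, hQk⟩ := ih (m := m + 1) (by rwa [add_right_comm] at h)
    obtain ⟨hk', hQk'⟩ := hk.schurStep
    refine ⟨hk', fun j hj => (hQk' j hj).trans ?_⟩
    rw [hQk _ (by omega), add_assoc, add_comm 1]

theorem schurComplement_alphaShift_mul_eq_zero {α : ℂ} {n : ℕ} {M : Matrix (Fin q) (Fin q) ℂ}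
    (hs : (blockHankel s (n + 1)).PosSemidef) (hA : (blockHankel (alphaShift α s) n).PosSemidef)
    (hM : schurComplement s n * M = 0) : schurComplement (alphaShift α s) n * M = 0 := by
  have hs' := posSemidef_blockHankel_of_le n.le_succ hs
  obtain ⟨P, hP₀, hP⟩ := hasPadeResidual_schurComplement hs'
  have hPM := hM ▸ hP.mul_C M
  simpa [hP₀] using (hPM.shift_zero (X_mul_mk_alphaShift α s)
    (hPM.coeff_two_mul_add_one_mul hs)).schurComplement_mul_constantCoeff hA

theorem schurComplement_succ_mul_eq_zero {α : ℂ} {n : ℕ} {M : Matrix (Fin q) (Fin q) ℂ}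
    (hs : (blockHankel s (n + 1)).PosSemidef)
    (hA : (blockHankel (alphaShift α s) (n + 1)).PosSemidef)
    (hM : schurComplement (alphaShift α s) n * M = 0) : schurComplement s (n + 1) * M = 0 := by
  have hA' := posSemidef_blockHankel_of_le n.le_succ hA
  obtain ⟨P, hP₀, hP⟩ := hasPadeResidual_schurComplement hA'
  have hPM := hM ▸ hP.mul_C M
  simpa [hP₀] using (hPM.unshift_zero (X_mul_mk_alphaShift α s)
    (hPM.coeff_two_mul_add_one_mul hA)).schurComplement_mul_constantCoeff hs

theorem IsStieltjesNND.isStieltjesRegular (h : IsStieltjesNND α (m + 1) s) :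
    IsStieltjesRegular α m s := by
  have hs (n) (hn : 2 * n ≤ m + 1) : (blockHankel s n).PosSemidef :=
    posSemidef_blockHankel_of_le (by omega) h.1
  have hA (n) (hn : 2 * n ≤ m) : (blockHankel (alphaShift (α : ℂ) s) n).PosSemidef :=
    posSemidef_blockHankel_of_le (by omega) (h.2 (by omega))
  refine ⟨fun j hj => conjTranspose_eq_of_isHermitian_blockHankel h.1.1 (by omega),
    fun n hn => ?_, fun n hn => ?_, fun j hj M hM => ?_⟩
  · rw [stieltjesParam_two_mul]
    exact hasPadeResidual_schurComplement (hs n (by omega))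
  · rw [stieltjesParam_two_mul_add_one]
    exact hasPadeResidual_schurComplement (hA n (by omega))
  · obtain ⟨n, rfl | rfl⟩ := Nat.even_or_odd' j
    · rw [stieltjesParam_two_mul] at hM
      rw [stieltjesParam_two_mul_add_one]
      exact schurComplement_alphaShift_mul_eq_zero (hs (n + 1) (by omega)) (hA n (by omega)) hM
    · rw [stieltjesParam_two_mul_add_one] at hM
      rw [add_assoc, one_add_one_eq_two, ← mul_add_one, stieltjesParam_two_mul]
      exact schurComplement_succ_mul_eq_zero (hs (n + 1) (by omega)) (hA (n + 1) (by omega)) hM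

theorem IsStieltjesNNDExt.exists_isStieltjesRegular {κ : ℕ∞} (h : IsStieltjesNNDExt α κ s)
    {l : ℕ} (hl : (l : ℕ∞) ≤ κ) : ∃ m, l ≤ m ∧ IsStieltjesRegular α m s := by
  induction κ using ENat.recTopCoe with
  | top => exact ⟨l, le_rfl, (h.2 rfl (l + 1)).isStieltjesRegular⟩
  | coe m =>
    obtain ⟨X, hX⟩ := h.1 m rfl
    refine ⟨m, by exact_mod_cast hl, hX.isStieltjesRegular.congr fun j hj => ?_⟩
    rw [Function.update_of_ne (by omega)]

end Stieltjes

end StieltjesSchur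

theorem theoremT1658 {q : ℕ} (α : ℝ) (κ : ℕ∞) (s : ℕ → Matrix (Fin q) (Fin q) ℂ)
    (hs : StieltjesSchur.IsStieltjesNNDExt α κ s) (k : ℕ) (hk : (k : ℕ∞) ≤ κ) :
    ∀ j : ℕ, ((k + j : ℕ) : ℕ∞) ≤ κ →
      StieltjesSchur.stieltjesParam (α : ℂ) (StieltjesSchur.schurTransform (α : ℂ) s k) j =
        StieltjesSchur.stieltjesParam (α : ℂ) s (k + j) := by
  intro j hj
  obtain ⟨m, hm, h⟩ := hs.exists_isStieltjesRegular hj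
  obtain ⟨d, rfl⟩ := Nat.exists_eq_add_of_le (le_self_add.trans hm)
  exact h.schurTransform.2 j (by omega)
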